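/- Let $M$ be an oriented matroid on the ground set $[n]=\{1,\dots,n\}$ with collection of signed circuits $\mathscr{C}$, and let $\omega\in\mathbb{R}^n$. For $C\in\mathscr{C}$ let $\mathrm{init}_\omega(C)$ be the signed set formed by the elements of $C$ of largest $\omega$-weight, with their signs in $C$. Let $\mathcal{F}=\mathcal{F}(\omega)$ be the flag $\emptyset=F_0\subset F_1\subset\dots\subset F_k\subset F_{k+1}=[n]$ of subsets such that $\omega$ is constant on each $F_i\setminus F_{i-1}$ and $\omega|_{F_i\setminus F_{i-1}}<\omega|_{F_{i+1}\setminus F_i}$ (for $n=0$ its only member is $\emptyset$). Let $M_{\mathcal{F}}=M_\omega$ be the oriented matroid on $[n]$ whose signed circuits are the inclusion-minimal signed sets among the $\mathrm{init}_\omega(C)$, $C\in\mathscr{C}$; it is acyclic if it has no signed circuit all of whose elements are positive. A covector of $M$ is a composition of finitely many (possibly zero) signed cocircuits of $M$. A flat of the underlying matroid of $M$ is called positive if it is $[n]$ or the set of zeros of a covector all of whose entries are $0$ or $+$. Then the following three conditions are equivalent: 1. $M_{\mathcal{F}}$ is acyclic. 2. For every signed circuit $C$ of $M$, $\mathrm{init}_\omega(C)$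 contains both a positive element and a negative element of $C$. 3. $\mathcal{F}$ is a flag of positive flats of $M$, i.e. every $F_i$, $0\le i\le k+1$, is a positive flat of $M$. -/

import Mathlib

/-- An oriented matroid on the ground set `α`, given by its collection of signed circuits.  A signed
subset `X = (X⁺, X⁻)` of `α` is encoded as a sign vector `X : α → SignType`, with
`X⁺ = {e | X e = 1}` and `X⁻ = {e | X e = -1}`; its support is `{e | X e ≠ 0}`. -/
structure OrientedMatroid (α : Type*) where
  /-- The collection of signed circuits. -/
  circuits : Set (α → SignType)
  zero_notMem : (0 : α → SignType) ∉ circuits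
  neg_mem : ∀ X ∈ circuits, -X ∈ circuits
  eq_or_eq_neg : ∀ X ∈ circuits, ∀ Y ∈ circuits, (∀ e, X e ≠ 0 → Y e ≠ 0) → X = Y ∨ X = -Y
  elim : ∀ X ∈ circuits, ∀ Y ∈ circuits, X ≠ -Y → ∀ e, X e = 1 → Y e = -1 →
    ∃ Z ∈ circuits, Z e = 0 ∧ (∀ f, Z f = 1 → X f = 1 ∨ Y f = 1) ∧
      (∀ f, Z f = -1 → X f = -1 ∨ Y f = -1)

namespace OrientedMatroid

/-- Inclusion of signed sets: `X⁺ ⊆ Y⁺` and `X⁻ ⊆ Y⁻`. -/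
def SignedSubset {α : Type*} (X Y : α → SignType) : Prop := ∀ e, X e ≠ 0 → X e = Y e

/-- The support of a signed set. -/
def supp {α : Type*} (X : α → SignType) : Set α := {e | X e ≠ 0}

/-- `M` is acyclic if it has no all-positive circuit. -/
def IsAcyclic {α : Type*} (M : OrientedMatroid α) : Prop :=
  ¬ ∃ C ∈ M.circuits, ∀ e, C e = 0 ∨ C e = 1

section circuitElimination

theorem elim_any {α : Type*} {𝒞 : Set (α → SignType)}
    (h : ∀ X ∈ 𝒞, ∀ Y ∈ 𝒞, X ≠ -Y → ∀ e, X e = 1 → Y e = -1 →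
      ∃ Z ∈ 𝒞, Z e = 0 ∧ (∀ f, Z f = 1 → X f = 1 ∨ Y f = 1) ∧
      (∀ f, Z f = -1 → X f = -1 ∨ Y f = -1))
    {X Y : α → SignType} (hX : X ∈ 𝒞) (hY : Y ∈ 𝒞) (hXY : X ≠ -Y) {e : α} (he : X e ≠ 0)
    (hYe : Y e = -X e) :
    ∃ Z ∈ 𝒞, Z e = 0 ∧ ∀ f, Z f = 0 ∨ Z f = X f ∨ Z f = Y f := by
  rcases SignType.trichotomy (X e) with h1 | h1 | h1
  · obtain ⟨Z, hZ, h0, hp, hn⟩ := h Y hY X hX (fun hh => hXY (by rw [hh, neg_neg])) e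
      (by rw [hYe, h1]; rfl) h1
    refine ⟨Z, hZ, h0, fun f => ?_⟩
    have := hp f; have := hn f
    rcases SignType.trichotomy (Z f) with h | h | h <;> grind
  · exact absurd h1 he
  · obtain ⟨Z, hZ, h0, hp, hn⟩ := h X hX Y hY hXY e h1 (by rw [hYe, h1])
    refine ⟨Z, hZ, h0, fun f => ?_⟩
    have := hp f; have := hn f
    rcases SignType.trichotomy (Z f) with h | h | h <;> grind

theorem sign_eq_or {a b : SignType} (ha : a ≠ 0) (hb : b ≠ 0) : a = b ∨ a = -b := by
  decide +revert

theorem sign_ne_neg {a : SignType} (ha : a ≠ 0) : a ≠ -a := by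
  decide +revert

theorem sign_neg_ne {a : SignType} : -a ≠ 0 ↔ a ≠ 0 := by
  decide +revert

/-- The axiom on supports follows from incomparability with respect to signed inclusion. -/
theorem eq_or_eq_neg_of_signed {α : Type*} [Finite α] {𝒞 : Set (α → SignType)}
    (hmin : ∀ X ∈ 𝒞, ∀ Y ∈ 𝒞, SignedSubset X Y → X = Y)
    (h : ∀ X ∈ 𝒞, ∀ Y ∈ 𝒞, X ≠ -Y → ∀ e, X e = 1 → Y e = -1 →
      ∃ Z ∈ 𝒞, Z e = 0 ∧ (∀ f, Z f = 1 → X f = 1 ∨ Y f = 1) ∧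
      (∀ f, Z f = -1 → X f = -1 ∨ Y f = -1))
    (Y : α → SignType) (hY : Y ∈ 𝒞) (X : α → SignType) (hX : X ∈ 𝒞)
    (hs : ∀ e, X e ≠ 0 → Y e ≠ 0) : X = Y ∨ X = -Y := by
  by_contra hne
  rw [not_or] at hne
  obtain ⟨hne1, hne2⟩ := hne
  induction hk : {f | X f ≠ 0 ∧ X f = -Y f}.ncard using Nat.strong_induction_on generalizing X with
  | _ k ih =>
  by_cases hd : ∃ f, X f ≠ 0 ∧ X f = -Y f
  · obtain ⟨f, hf0, hf⟩ := hd
    obtain ⟨Z, hZ, hZf, hZs⟩ := elim_any h hX hY hne2 hf0 (by rw [hf, neg_neg])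
    have hYf : Y f ≠ 0 := hs f hf0
    refine ih _ ?_ Z hZ ?_ ?_ ?_ rfl
    · rw [← hk]
      refine Set.ncard_lt_ncard ?_ (Set.toFinite _)
      refine ⟨fun g hg => ?_, fun hsub => ?_⟩
      · obtain ⟨hg0, hg⟩ := hg
        rcases hZs g with h1 | h1 | h1
        · exact absurd h1 hg0
        · exact ⟨h1 ▸ hg0, h1 ▸ hg⟩
        · exact absurd (h1.symm.trans hg) (sign_ne_neg (h1 ▸ hg0))
      · exact (hsub (show f ∈ {f | X f ≠ 0 ∧ X f = -Y f} from ⟨hf0, hf⟩)).1 hZf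
    · intro g hg
      rcases hZs g with h1 | h1 | h1
      · exact absurd h1 hg
      · exact hs g (h1 ▸ hg)
      · exact h1 ▸ hg
    · rintro rfl; exact hYf hZf
    · rintro rfl; exact sign_neg_ne.2 hYf hZf
  · push Not at hd
    exact hne1 (hmin X hX Y hY fun e he => (sign_eq_or he (hs e he)).resolve_right (hd e he))

/-- An oriented matroid from the axioms stated with signed inclusion. -/
def ofSigned {α : Type*} [Finite α] (𝒞 : Set (α → SignType))
    (h0 : (0 : α → SignType) ∉ 𝒞) (hneg : ∀ X ∈ 𝒞, -X ∈ 𝒞)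
    (hmin : ∀ X ∈ 𝒞, ∀ Y ∈ 𝒞, SignedSubset X Y → X = Y)
    (h : ∀ X ∈ 𝒞, ∀ Y ∈ 𝒞, X ≠ -Y → ∀ e, X e = 1 → Y e = -1 →
      ∃ Z ∈ 𝒞, Z e = 0 ∧ (∀ f, Z f = 1 → X f = 1 ∨ Y f = 1) ∧
      (∀ f, Z f = -1 → X f = -1 ∨ Y f = -1)) : OrientedMatroid α where
  circuits := 𝒞
  zero_notMem := h0
  neg_mem := hneg
  eq_or_eq_neg X hX Y hY hs := eq_or_eq_neg_of_signed hmin h Y hY X hX hs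
  elim := h

end circuitElimination

section underlying

theorem exists_circuit_diff {α : Type*} (M : OrientedMatroid α) {X Y : α → SignType}
    (hX : X ∈ M.circuits) (hY : Y ∈ M.circuits) (hne : supp X ≠ supp Y) {e : α}
    (heX : e ∈ supp X) (heY : e ∈ supp Y) :
    ∃ Z ∈ M.circuits, supp Z ⊆ (supp X ∪ supp Y) \ {e} := by
  have key : ∀ Y' ∈ M.circuits, supp Y' = supp Y → Y' e = -X e →
      ∃ Z ∈ M.circuits, supp Z ⊆ (supp X ∪ supp Y) \ {e} := by
    intro Y' hY' hs hYe
    have hn : X ≠ -Y' := by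
      rintro rfl
      apply hne
      rw [← hs]
      ext f
      exact sign_neg_ne
    obtain ⟨Z, hZ, hZe, hZs⟩ := elim_any M.elim hX hY' hn heX hYe
    refine ⟨Z, hZ, fun f hf => ⟨?_, ?_⟩⟩
    · rcases hZs f with h | h | h
      · exact absurd h hf
      · exact Or.inl (show X f ≠ 0 from h ▸ hf)
      · exact Or.inr (hs ▸ (show Y' f ≠ 0 from h ▸ hf))
    · rintro rfl; exact hf hZe
  rcases sign_eq_or heY heX with h | h
  · exact key (-Y) (M.neg_mem Y hY) (by ext f; exact sign_neg_ne) (by rw [Pi.neg_apply, h])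
  · exact key Y hY rfl h

theorem indep_aug {α : Type*} [Finite α] (M : OrientedMatroid α) (I J : Set α)
    (hI : ∀ C ∈ M.circuits, ¬ supp C ⊆ I) (hJ : ∀ C ∈ M.circuits, ¬ supp C ⊆ J)
    (hlt : I.ncard < J.ncard) :
    ∃ e ∈ J, e ∉ I ∧ ∀ C ∈ M.circuits, ¬ supp C ⊆ insert e I := by
  induction hk : (I \ J).ncard using Nat.strong_induction_on generalizing I with
  | _ k ih =>
  obtain ⟨e, heJ, heI⟩ : ∃ e ∈ J, e ∉ I := by
    by_contra! hsub
    exact absurd (Set.ncard_le_ncard hsub (Set.toFinite _)) (not_le.2 hlt)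
  by_cases hC : ∀ C ∈ M.circuits, ¬ supp C ⊆ insert e I
  · exact ⟨e, heJ, heI, hC⟩
  push Not at hC
  obtain ⟨C, hC, hCs⟩ := hC
  obtain ⟨x, hxC, hxJ⟩ := Set.not_subset.1 (hJ C hC)
  have hxe : x ≠ e := by rintro rfl; exact hxJ heJ
  have hxI : x ∈ I := (hCs hxC).resolve_left hxe
  have heC : e ∈ supp C := by
    by_contra he
    exact hI C hC fun f hf => (hCs hf).resolve_left (by rintro rfl; exact he hf)
  have hI' : ∀ D ∈ M.circuits, ¬ supp D ⊆ insert e (I \ {x}) := by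
    intro D hD hDs
    have heD : e ∈ supp D := by
      by_contra he
      exact hI D hD fun f hf => ((hDs hf).resolve_left (by rintro rfl; exact he hf)).1
    have hne : supp C ≠ supp D := by
      intro h
      rcases hDs (h ▸ hxC) with h1 | h1
      · exact hxe h1
      · exact h1.2 rfl
    obtain ⟨Z, hZ, hZs⟩ := M.exists_circuit_diff hC hD hne heC heD
    refine hI Z hZ fun f hf => ?_
    obtain ⟨h1 | h1, h2⟩ := hZs hf
    · exact (hCs h1).resolve_left h2
    · exact ((hDs h1).resolve_left h2).1
  have hcard : (insert e (I \ {x})).ncard = I.ncard := by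
    rw [Set.ncard_insert_of_notMem (fun h => heI h.1) (Set.toFinite _),
      Set.ncard_sdiff_singleton_add_one hxI (Set.toFinite _)]
  obtain ⟨g, hgJ, hgI', hg⟩ := ih _ (by
    rw [← hk]
    refine Set.ncard_lt_ncard ⟨?_, fun h => ?_⟩ (Set.toFinite _)
    · rintro f ⟨rfl | hf, hfJ⟩
      · exact absurd heJ hfJ
      · exact ⟨hf.1, hfJ⟩
    · rcases (h ⟨hxI, hxJ⟩).1 with h1 | h1
      · exact hxe h1
      · exact h1.2 rfl) (insert e (I \ {x})) hI' (by rw [hcard]; exact hlt) rfl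
  have hge : g ≠ e := by rintro rfl; exact hgI' (Or.inl rfl)
  have hgx : g ≠ x := by rintro rfl; exact hxJ hgJ
  have hgI : g ∉ I := fun h => hgI' (Or.inr ⟨h, hgx⟩)
  refine ⟨g, hgJ, hgI, fun D hD hDs => ?_⟩
  by_cases hxD : x ∈ supp D
  · have hgD : g ∈ supp D := by
      by_contra hn
      exact hI D hD fun f hf => (hDs hf).resolve_left (by rintro rfl; exact hn hf)
    have hne : supp C ≠ supp D := by
      intro h
      rcases hCs (h ▸ hgD) with h1 | h1
      · exact hge h1
      · exact hgI h1
    obtain ⟨Z, hZ, hZs⟩ := M.exists_circuit_diff hC hD hne hxC hxD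
    refine hg Z hZ fun f hf => ?_
    obtain ⟨h1 | h1, h2⟩ := hZs hf
    · rcases hCs h1 with h3 | h3
      · exact Or.inr (Or.inl h3)
      · exact Or.inr (Or.inr ⟨h3, h2⟩)
    · rcases hDs h1 with h3 | h3
      · exact Or.inl h3
      · exact Or.inr (Or.inr ⟨h3, h2⟩)
  · refine hg D hD fun f hf => ?_
    rcases hDs hf with h3 | h3
    · exact Or.inl h3
    · exact Or.inr (Or.inr ⟨h3, by rintro rfl; exact hxD hf⟩)

/-- The underlying (unoriented) matroid: a set is independent if it contains the support of no
signed circuit. -/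
def underlying {α : Type*} [Finite α] (M : OrientedMatroid α) : Matroid α :=
  (IndepMatroid.ofFinite (E := Set.univ) Set.finite_univ
    (fun I => ∀ C ∈ M.circuits, ¬ supp C ⊆ I)
    (fun C hC hs => M.zero_notMem (by
      have : C = 0 := funext fun e => by_contra fun he => hs he
      exact this ▸ hC))
    (fun _ _ hJ hIJ C hC hs => hJ C hC (hs.trans hIJ))
    (fun I J hI hJ hlt => M.indep_aug I J hI hJ hlt)
    (fun _ _ => Set.subset_univ _)).matroid

end underlying

section covectors

/-- Two signed sets are orthogonal if their supports are disjoint or there are elements of the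
common support on which they agree and elements on which they disagree. -/
def Orthogonal {α : Type*} (X Y : α → SignType) : Prop :=
  (∃ e, X e * Y e = 1) ↔ (∃ e, X e * Y e = -1)

/-- The signed cocircuits of `M`, i.e. the signed circuits of the dual oriented matroid: the signed
sets that are supported on a cocircuit of the underlying matroid and are orthogonal to all signed
circuits. -/
def IsSignedCocircuit {α : Type*} [Finite α] (M : OrientedMatroid α) (Y : α → SignType) : Prop :=
  M.underlying.IsCocircuit (supp Y) ∧ ∀ C ∈ M.circuits, Orthogonal C Y

/-- The composition `X ∘ Y` of two sign vectors. -/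
def comp {α : Type*} (X Y : α → SignType) : α → SignType :=
  fun e => if X e = 0 then Y e else X e

/-- The covectors of `M` are the compositions of finitely many (possibly zero) signed cocircuits. -/
inductive IsCovector {α : Type*} [Finite α] (M : OrientedMatroid α) : (α → SignType) → Prop
  | zero : IsCovector M 0
  | comp (X Y : α → SignType) : M.IsSignedCocircuit X → IsCovector M Y → IsCovector M (comp X Y)

/-- A flat is positive if it is the whole ground set or the zero set of a positive covector, i.e.
of a covector with all entries `0` or `+`. -/
def IsPositiveFlat {α : Type*} [Finite α] (M : OrientedMatroid α) (F : Set α) : Prop :=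
  M.underlying.IsFlat F ∧
    (F = Set.univ ∨ ∃ v, M.IsCovector v ∧ (∀ e, v e = 0 ∨ v e = 1) ∧ F = {e | v e = 0})

end covectors

section flags

/-- The members of the flag `∅ = F₀ ⊂ F₁ ⊂ ⋯ ⊂ F_{k+1}` of a weight vector `ω`: the empty set and
the sublevel sets of `ω` at the values that it takes.  If `w₁ < ⋯ < w_{k+1}` are these values, then
`Fᵢ = {f | ω f ≤ wᵢ}`, so `ω` is constant on `Fᵢ \ Fᵢ₋₁`, with values increasing in `i`. -/
def flag {α : Type*} (ω : α → ℝ) : Set (Set α) :=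
  {F | F = ∅ ∨ ∃ e, F = {f | ω f ≤ ω e}}

end flags

section initial

open Classical in
/-- `init_ω(C)`: the elements of `C` of largest weight, with their signs in `C`. -/
noncomputable def initSet {α : Type*} (ω : α → ℝ) (C : α → SignType) : α → SignType :=
  fun e => if ∀ f, C f ≠ 0 → ω f ≤ ω e then C e else 0

/-- `init_ω(𝒞)`: the inclusion-minimal signed sets among the `init_ω(C)`, for `C` a circuit. -/
def initCircuits {α : Type*} (M : OrientedMatroid α) (ω : α → ℝ) : Set (α → SignType) :=
  {X | (∃ C ∈ M.circuits, X = initSet ω C) ∧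
    ∀ C ∈ M.circuits, SignedSubset (initSet ω C) X → initSet ω C = X}

open Classical in
/-- The restriction of a signed set to the complement of `F`. -/
noncomputable def del {α : Type*} (F : Set α) (C : α → SignType) : α → SignType :=
  fun e => if e ∈ F then 0 else C e

theorem del_apply_of_notMem {α : Type*} {F : Set α} {C : α → SignType} {e : α} (h : e ∉ F) :
    del F C e = C e := if_neg h

theorem del_apply_of_mem {α : Type*} {F : Set α} {C : α → SignType} {e : α} (h : e ∈ F) :
    del F C e = 0 := if_pos h

theorem del_single_ne {α : Type*} {C : α → SignType} {e g : α} (h : g ≠ e) :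
    del {e} C g = C g := del_apply_of_notMem h

theorem del_single_eq {α : Type*} {C : α → SignType} {e g : α} (h : g = e) :
    del {e} C g = 0 := del_apply_of_mem h

theorem del_neg {α : Type*} (F : Set α) (C : α → SignType) : del F (-C) = -del F C := by
  ext e
  by_cases h : e ∈ F
  · simp only [del, if_pos h, Pi.neg_apply, neg_zero]
  · simp only [del, if_neg h, Pi.neg_apply]

theorem sign_vec_neg_ne {α : Type*} {X : α → SignType} (h : X ≠ 0) : -X ≠ 0 := by
  intro h0
  exact h (funext fun e => by_contra fun he => sign_neg_ne.2 he (congrFun h0 e))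

theorem signedSubset_neg {α : Type*} {X Y : α → SignType} (h : SignedSubset X Y) :
    SignedSubset (-X) (-Y) := fun e he => congrArg Neg.neg (h e (sign_neg_ne.1 he))

theorem initSet_neg {α : Type*} (ω : α → ℝ) (C : α → SignType) :
    initSet ω (-C) = -initSet ω C := by
  ext e
  have hiff : (∀ f, (-C) f ≠ 0 → ω f ≤ ω e) ↔ (∀ f, C f ≠ 0 → ω f ≤ ω e) :=
    forall_congr' fun f => imp_congr_left sign_neg_ne
  by_cases h : ∀ f, C f ≠ 0 → ω f ≤ ω e
  · exact (if_pos (hiff.2 h)).trans (congrArg Neg.neg (if_pos h).symm)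
  · have h2 : (-initSet ω C) e = 0 := by
      rw [Pi.neg_apply, show initSet ω C e = 0 from if_neg h]; rfl
    exact (if_neg fun h' => h (hiff.1 h')).trans h2.symm

/-- The nonempty sets `C \ e` that are minimal with respect to signed inclusion. -/
def contractSet {α : Type*} (K : OrientedMatroid α) (e : α) : Set (α → SignType) :=
  {X | X ≠ 0 ∧ (∃ C ∈ K.circuits, X = del {e} C) ∧
    ∀ D ∈ K.circuits, del {e} D ≠ 0 → SignedSubset (del {e} D) X → del {e} D = X}

theorem contract_minimal {α : Type*} (K : OrientedMatroid α) {e : α} {C : α → SignType}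
    (hC : C ∈ K.circuits) (he : C e ≠ 0) {f : α} (hfe : f ≠ e) (hf : C f ≠ 0) :
    del {e} C ∈ contractSet K e := by
  refine ⟨fun h => hf ?_, ⟨C, hC, rfl⟩, fun D hD hD0 hs => ?_⟩
  · have := congrFun h f
    rwa [del_single_ne hfe] at this
  · have hsupp : ∀ g, D g ≠ 0 → C g ≠ 0 := by
      intro g hg
      by_cases hge : g = e
      · exact hge ▸ he
      · have h1 := hs g (by rwa [del_single_ne hge])
        rw [del_single_ne hge, del_single_ne hge] at h1
        exact h1 ▸ hg
    rcases K.eq_or_eq_neg D hD C hC hsupp with rfl | rfl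
    · rfl
    · have h1 := hs f (by rw [del_single_ne hfe]; exact sign_neg_ne.2 hf)
      rw [del_single_ne hfe, del_single_ne hfe] at h1
      exact absurd h1.symm (sign_ne_neg hf)

theorem contract_conformal_aux {α : Type*} [Finite α] (K : OrientedMatroid α) {e f : α}
    {C : α → SignType} (hC : C ∈ K.circuits) (he : C e = 0) (hfe : f ≠ e) (hf : C f ≠ 0)
    (D : α → SignType) (hD : D ∈ K.circuits) (hDe : D e ≠ 0) (hDf : D f = C f)
    (hs : ∀ g, g ≠ e → D g ≠ 0 → C g ≠ 0) :
    ∃ D ∈ K.circuits, D e ≠ 0 ∧ D f = C f ∧ SignedSubset (del {e} D) (del {e} C) := by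
  induction hk : {g | g ≠ e ∧ D g ≠ 0 ∧ D g = -C g}.ncard using Nat.strong_induction_on
    generalizing D with
  | _ k ih =>
  by_cases hd : ∃ h, h ≠ e ∧ D h ≠ 0 ∧ D h = -C h
  · obtain ⟨h, hhe, hh0, hh⟩ := hd
    have hCh : C h ≠ 0 := hs h hhe hh0
    have hn : C ≠ -D := by
      rintro rfl; exact sign_neg_ne.2 hDe he
    obtain ⟨Z, hZ, hZh, hZs⟩ := elim_any K.elim hC hD hn hCh hh
    have hZe : Z e ≠ 0 := by
      intro hZe
      have hsub : ∀ g, Z g ≠ 0 → C g ≠ 0 := by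
        intro g hg
        have hge : g ≠ e := by rintro rfl; exact hg hZe
        rcases hZs g with h1 | h1 | h1
        · exact absurd h1 hg
        · exact h1 ▸ hg
        · exact hs g hge (h1 ▸ hg)
      rcases K.eq_or_eq_neg Z hZ C hC hsub with rfl | rfl
      · exact hCh hZh
      · exact sign_neg_ne.2 hCh hZh
    have hZeD : Z e = D e := by
      rcases hZs e with h1 | h1 | h1
      · exact absurd h1 hZe
      · exact absurd (h1.trans he) hZe
      · exact h1
    by_cases hZf : Z f = 0
    · exfalso
      have hn' : Z ≠ -(-D) := by
        rw [neg_neg]; rintro rfl; exact hh0 hZh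
      obtain ⟨W, hW, hWe, hWs⟩ := elim_any K.elim hZ (K.neg_mem D hD) hn' hZe
        (by rw [Pi.neg_apply, hZeD])
      have hsub : ∀ g, W g ≠ 0 → C g ≠ 0 := by
        intro g hg
        have hge : g ≠ e := by rintro rfl; exact hg hWe
        rcases hWs g with h1 | h1 | h1
        · exact absurd h1 hg
        · rcases hZs g with h2 | h2 | h2
          · exact absurd (h1.trans h2) hg
          · exact (h1.trans h2) ▸ hg
          · exact hs g hge ((h1.trans h2) ▸ hg)
        · exact hs g hge (sign_neg_ne.1 (fun h => hg (h1.trans h)))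
      have key : ∀ g, W g = C g → Z g = 0 → D g = C g → C g = 0 := by
        intro g h1 h2 h3
        by_contra h4
        rcases hWs g with h5 | h5 | h5
        · exact h4 (h1.symm.trans h5)
        · exact h4 (h1.symm.trans (h5.trans h2))
        · rw [Pi.neg_apply, h3, h1] at h5
          exact sign_ne_neg h4 h5
      rcases K.eq_or_eq_neg W hW C hC hsub with rfl | rfl
      · exact hf (key f rfl hZf hDf)
      · rcases hWs h with h5 | h5 | h5
        · exact sign_neg_ne.2 hCh h5
        · exact sign_neg_ne.2 hCh (h5.trans hZh)
        · rw [Pi.neg_apply, Pi.neg_apply, hh, neg_neg] at h5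
          exact sign_ne_neg hCh h5.symm
    · refine ih _ ?_ Z hZ hZe ?_ ?_ rfl
      · rw [← hk]
        refine Set.ncard_lt_ncard ⟨?_, fun hsub => ?_⟩ (Set.toFinite _)
        · rintro g ⟨hge, hg0, hg⟩
          rcases hZs g with h1 | h1 | h1
          · exact absurd h1 hg0
          · exact absurd (h1.symm.trans hg) (sign_ne_neg (h1 ▸ hg0))
          · exact ⟨hge, h1 ▸ hg0, h1 ▸ hg⟩
        · exact (hsub (show h ∈ {g | g ≠ e ∧ D g ≠ 0 ∧ D g = -C g} from ⟨hhe, hh0, hh⟩)).2.1 hZh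
      · rcases hZs f with h1 | h1 | h1
        · exact absurd h1 hZf
        · exact h1
        · exact h1.trans hDf
      · intro g hge hg
        rcases hZs g with h1 | h1 | h1
        · exact absurd h1 hg
        · exact h1 ▸ hg
        · exact hs g hge (h1 ▸ hg)
  · push Not at hd
    refine ⟨D, hD, hDe, hDf, fun g hg => ?_⟩
    by_cases hge : g = e
    · exact absurd (del_single_eq hge) hg
    · rw [del_single_ne hge] at hg ⊢
      rw [del_single_ne hge]
      exact (sign_eq_or hg (hs g hge hg)).resolve_right (hd g hge hg)

theorem contract_conformal {α : Type*} [Finite α] (K : OrientedMatroid α) {e f : α}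
    {C : α → SignType} (hC : C ∈ K.circuits) (hfe : f ≠ e) (hf : C f ≠ 0) :
    ∃ A ∈ contractSet K e, A f ≠ 0 ∧ SignedSubset A (del {e} C) := by
  by_cases he : C e = 0
  swap
  · exact ⟨_, contract_minimal K hC he hfe hf, by rwa [del_single_ne hfe], fun _ _ => rfl⟩
  suffices hsuff : del {e} C ∈ contractSet K e ∨ ∃ D ∈ K.circuits, D e ≠ 0 ∧ D f = C f ∧
      ∀ g, g ≠ e → D g ≠ 0 → C g ≠ 0 by
    rcases hsuff with h | ⟨D, hD, hDe, hDf, hs⟩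
    · exact ⟨_, h, by rwa [del_single_ne hfe], fun _ _ => rfl⟩
    · obtain ⟨D, hD, hDe, hDf, hs⟩ := contract_conformal_aux K hC he hfe hf D hD hDe hDf hs
      exact ⟨_, contract_minimal K hD hDe hfe (hDf ▸ hf),
        by rw [del_single_ne hfe, hDf]; exact hf, hs⟩
  by_contra! hcon
  obtain ⟨hnm, hno⟩ := hcon
  apply hnm
  refine ⟨fun h => hf ?_, ⟨C, hC, rfl⟩, fun D hD hD0 hs => ?_⟩
  · have := congrFun h f
    rwa [del_single_ne hfe] at this
  have hs' : ∀ g, g ≠ e → D g ≠ 0 → D g = C g := by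
    intro g hge hg
    have h1 := hs g (by rwa [del_single_ne hge])
    rwa [del_single_ne hge, del_single_ne hge] at h1
  obtain ⟨h, hh0⟩ : ∃ h, del {e} D h ≠ 0 := by
    by_contra! hall
    exact hD0 (funext hall)
  have hhe : h ≠ e := by
    rintro rfl; exact hh0 (del_single_eq rfl)
  rw [del_single_ne hhe] at hh0
  have hDh := hs' h hhe hh0
  by_cases hDe : D e = 0
  · have hsub : ∀ g, D g ≠ 0 → C g ≠ 0 := by
      intro g hg
      have hge : g ≠ e := by rintro rfl; exact hg hDe
      exact hs' g hge hg ▸ hg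
    rcases K.eq_or_eq_neg D hD C hC hsub with rfl | rfl
    · rfl
    · exact absurd hDh.symm (sign_ne_neg (hDh ▸ hh0))
  exfalso
  by_cases hDf : D f = 0
  swap
  · obtain ⟨g, hge, hg, hg'⟩ := hno D hD hDe (hs' f hfe hDf)
    exact hg (hs' g hge hg ▸ hg')
  have hCh : C h ≠ 0 := hDh ▸ hh0
  have hn : C ≠ -(-D) := by
    rw [neg_neg]; rintro rfl; exact hDe he
  obtain ⟨Z, hZ, hZh, hZs⟩ := elim_any K.elim hC (K.neg_mem D hD) hn hCh
    (by rw [Pi.neg_apply, hDh])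
  have hZsub : ∀ g, g ≠ e → Z g ≠ 0 → C g ≠ 0 := by
    intro g hge hg
    rcases hZs g with h1 | h1 | h1
    · exact absurd h1 hg
    · exact h1 ▸ hg
    · have h2 : D g ≠ 0 := sign_neg_ne.1 (fun h => hg (h1.trans h))
      exact hs' g hge h2 ▸ h2
  have hZe : Z e ≠ 0 := by
    intro hZe
    rcases K.eq_or_eq_neg Z hZ C hC
      (fun g hg => hZsub g (by rintro rfl; exact hg hZe) hg) with rfl | rfl
    · exact hCh hZh
    · exact sign_neg_ne.2 hCh hZh
  have hZeD : Z e = -D e := by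
    rcases hZs e with h1 | h1 | h1
    · exact absurd h1 hZe
    · exact absurd (h1.trans he) hZe
    · exact h1
  have hn' : Z ≠ -D := by
    rintro rfl; exact sign_neg_ne.2 hh0 hZh
  obtain ⟨W, hW, hWe, hWs⟩ := elim_any K.elim hZ hD hn' hZe (by rw [hZeD, neg_neg])
  have hWsub : ∀ g, W g ≠ 0 → C g ≠ 0 := by
    intro g hg
    have hge : g ≠ e := by rintro rfl; exact hg hWe
    rcases hWs g with h1 | h1 | h1
    · exact absurd h1 hg
    · exact hZsub g hge (h1 ▸ hg)
    · have h2 : D g ≠ 0 := h1 ▸ hg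
      exact hs' g hge h2 ▸ h2
  have hWf : W f ≠ 0 := by
    rcases K.eq_or_eq_neg W hW C hC hWsub with rfl | rfl
    · exact hf
    · exact sign_neg_ne.2 hf
  have hZf : Z f = C f := by
    rcases hWs f with h1 | h1 | h1
    · exact absurd h1 hWf
    · rcases hZs f with h2 | h2 | h2
      · exact absurd (h1.trans h2) hWf
      · exact h2
      · rw [Pi.neg_apply, hDf, neg_zero] at h2
        exact absurd (h1.trans h2) hWf
    · exact absurd (h1.trans hDf) hWf
  obtain ⟨g, hge, hg, hg'⟩ := hno Z hZ hZe hZf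
  exact hZsub g hge hg hg'

theorem contractSet_elim {α : Type*} [Finite α] (K : OrientedMatroid α) (e : α) :
    ∀ X ∈ contractSet K e, ∀ Y ∈ contractSet K e, X ≠ -Y → ∀ g, X g = 1 → Y g = -1 →
      ∃ Z ∈ contractSet K e, Z g = 0 ∧ (∀ f, Z f = 1 → X f = 1 ∨ Y f = 1) ∧
      (∀ f, Z f = -1 → X f = -1 ∨ Y f = -1) := by
  rintro _ ⟨hX0, ⟨C, hC, rfl⟩, -⟩ _ ⟨hY0, ⟨D, hD, rfl⟩, -⟩ hne g hXg hYg
  have hge : g ≠ e := by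
    rintro rfl
    rw [del_single_eq rfl] at hXg
    exact absurd hXg (by decide)
  rw [del_single_ne hge] at hXg hYg
  obtain ⟨Z, hZ, hZg, hZp, hZn⟩ := K.elim C hC D hD
    (by rintro rfl; exact hne (del_neg _ _)) g hXg hYg
  have hloop : ∀ B ∈ K.circuits, del {e} B ≠ 0 → (∀ f, f ≠ e → Z f = 0) → B e ≠ 0 → False := by
    intro B hB hB0 hall hBe
    have hsub : ∀ f, Z f ≠ 0 → B f ≠ 0 := by
      intro f hf
      have hfe : f = e := by_contra fun h => hf (hall f h)
      exact hfe ▸ hBe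
    apply hB0
    ext f
    by_cases hfe : f = e
    · rw [del_single_eq hfe]; rfl
    · rw [del_single_ne hfe]
      rcases K.eq_or_eq_neg Z hZ B hB hsub with rfl | rfl
      · exact hall f hfe
      · exact by_contra fun h => sign_neg_ne.2 h (hall f hfe)
  obtain ⟨f, hfe, hf⟩ : ∃ f, f ≠ e ∧ Z f ≠ 0 := by
    by_contra! hall
    have hZe : Z e ≠ 0 := by
      intro h
      have : Z = 0 := funext fun f => by
        by_cases hfe : f = e
        · exact hfe ▸ h
        · exact hall f hfe
      exact K.zero_notMem (this ▸ hZ)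
    have hor : C e ≠ 0 ∨ D e ≠ 0 := by
      have h1 := hZp e
      have h2 := hZn e
      rcases SignType.trichotomy (Z e) with h | h | h
      · rcases h2 h with h | h <;> simp [h]
      · exact absurd h hZe
      · rcases h1 h with h | h <;> simp [h]
    rcases hor with h | h
    · exact hloop C hC hX0 hall h
    · exact hloop D hD hY0 hall h
  obtain ⟨A, hA, -, hAs⟩ := contract_conformal K hZ hfe hf
  have hAZ : ∀ f, A f ≠ 0 → f ≠ e ∧ A f = Z f := by
    intro f hf
    have h1 := hAs f hf
    by_cases hfe : f = e
    · rw [del_single_eq hfe] at h1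
      exact absurd h1 hf
    · exact ⟨hfe, h1.trans (del_single_ne hfe)⟩
  refine ⟨A, hA, by_contra fun h => h ((hAZ g h).2.trans hZg), fun f hf => ?_, fun f hf => ?_⟩
  · obtain ⟨h1, h2⟩ := hAZ f (by rw [hf]; decide)
    rw [del_single_ne h1, del_single_ne h1]
    exact hZp f (h2 ▸ hf)
  · obtain ⟨h1, h2⟩ := hAZ f (by rw [hf]; decide)
    rw [del_single_ne h1, del_single_ne h1]
    exact hZn f (h2 ▸ hf)

/-- Contraction of one element. -/
def contractElem {α : Type*} [Finite α] (K : OrientedMatroid α) (e : α) : OrientedMatroid α :=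
  ofSigned (contractSet K e) (fun h => h.1 rfl)
    (by
      rintro _ ⟨h0, ⟨C, hC, rfl⟩, hmin⟩
      refine ⟨sign_vec_neg_ne h0, ⟨-C, K.neg_mem C hC, (del_neg _ _).symm⟩, fun D hD hD0 hs => ?_⟩
      have h1 := hmin (-D) (K.neg_mem D hD) (by rw [del_neg]; exact sign_vec_neg_ne hD0)
        (by rw [del_neg]; simpa using signedSubset_neg hs)
      rw [← h1, del_neg, neg_neg])
    (by
      rintro _ ⟨h0, ⟨C, hC, rfl⟩, -⟩ Y ⟨-, -, hmin⟩ hs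
      exact hmin C hC h0 hs)
    (contractSet_elim K e)

theorem exists_contract {α : Type*} [Finite α] (K : OrientedMatroid α) (F : Set α) :
    ∃ N : OrientedMatroid α, (∀ X ∈ N.circuits, ∃ C ∈ K.circuits, X = del F C) ∧
      ∀ C ∈ K.circuits, ∀ f ∉ F, C f ≠ 0 → ∃ A ∈ N.circuits, A f ≠ 0 ∧
        SignedSubset A (del F C) := by
  induction F, Set.toFinite F using Set.Finite.induction_on with
  | empty =>
    refine ⟨K, fun X hX => ⟨X, hX, ?_⟩, fun C hC f _ hf => ⟨C, hC, hf, fun g _ => ?_⟩⟩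
    · ext g; rw [del_apply_of_notMem (Set.notMem_empty g)]
    · rw [del_apply_of_notMem (Set.notMem_empty g)]
  | @insert e F _ _ ih =>
    obtain ⟨N, h1, h2⟩ := ih
    have hdel : ∀ C : α → SignType, del {e} (del F C) = del (insert e F) C := by
      intro C
      ext g
      by_cases hg : g = e
      · rw [del_single_eq hg, del_apply_of_mem (Set.mem_insert_iff.2 (Or.inl hg))]
      · rw [del_single_ne hg]
        by_cases hgF : g ∈ F
        · rw [del_apply_of_mem hgF, del_apply_of_mem (Set.mem_insert_of_mem e hgF)]
        · rw [del_apply_of_notMem hgF, del_apply_of_notMem (fun h => (Set.mem_insert_iff.1 h).elim hg hgF)]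
    refine ⟨N.contractElem e, ?_, ?_⟩
    · rintro X ⟨-, ⟨A, hA, rfl⟩, -⟩
      obtain ⟨C, hC, rfl⟩ := h1 A hA
      exact ⟨C, hC, hdel C⟩
    · intro C hC f hf hCf
      obtain ⟨A, hA, hAf, hAs⟩ := h2 C hC f (fun h => hf (Or.inr h)) hCf
      obtain ⟨B, hB, hBf, hBs⟩ := contract_conformal N hA (fun h => hf (Or.inl h)) hAf
      refine ⟨B, hB, hBf, fun g hg => ?_⟩
      have h3 := hBs g hg
      by_cases hge : g = e
      · rw [del_single_eq hge] at h3
        exact absurd h3 hg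
      · rw [del_single_ne hge] at h3
        rw [h3, hAs g (h3 ▸ hg), ← hdel, del_single_ne hge]

/-- Restriction to a subset of the ground set. -/
def restrict {α : Type*} (K : OrientedMatroid α) (S : Set α) : OrientedMatroid α where
  circuits := {C | C ∈ K.circuits ∧ ∀ e, C e ≠ 0 → e ∈ S}
  zero_notMem h := K.zero_notMem h.1
  neg_mem X hX := ⟨K.neg_mem X hX.1, fun e he => hX.2 e (sign_neg_ne.1 he)⟩
  eq_or_eq_neg X hX Y hY h := K.eq_or_eq_neg X hX.1 Y hY.1 h
  elim X hX Y hY hne e h1 h2 := by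
    obtain ⟨Z, hZ, hZe, hp, hn⟩ := K.elim X hX.1 Y hY.1 hne e h1 h2
    refine ⟨Z, ⟨hZ, fun f hf => ?_⟩, hZe, hp, hn⟩
    rcases SignType.trichotomy (Z f) with h | h | h
    · rcases hn f h with h | h
      · exact hX.2 f (by rw [h]; decide)
      · exact hY.2 f (by rw [h]; decide)
    · exact absurd h hf
    · rcases hp f h with h | h
      · exact hX.2 f (by rw [h]; decide)
      · exact hY.2 f (by rw [h]; decide)

theorem initSet_ne_zero {α : Type*} {ω : α → ℝ} {C : α → SignType} {e : α} :
    initSet ω C e ≠ 0 ↔ C e ≠ 0 ∧ ∀ f, C f ≠ 0 → ω f ≤ ω e := by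
  unfold initSet
  split_ifs with h
  · exact ⟨fun h1 => ⟨h1, h⟩, fun h1 => h1.1⟩
  · exact ⟨fun h1 => absurd rfl h1, fun h1 => absurd h1.2 h⟩

theorem initSet_apply {α : Type*} {ω : α → ℝ} {C : α → SignType} {e : α}
    (h : initSet ω C e ≠ 0) : initSet ω C e = C e := by
  have := (initSet_ne_zero.1 h).2
  simp only [initSet, if_pos this]

theorem exists_initSet_ne_zero {α : Type*} [Finite α] (M : OrientedMatroid α) (ω : α → ℝ)
    {C : α → SignType} (hC : C ∈ M.circuits) : ∃ e, initSet ω C e ≠ 0 := by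
  have hne : (supp C).Nonempty := by
    by_contra h
    rw [Set.not_nonempty_iff_eq_empty] at h
    refine M.zero_notMem ((funext fun e => by_contra fun he => ?_ : C = 0) ▸ hC)
    exact Set.notMem_empty e (h ▸ he)
  obtain ⟨e, he, hmax⟩ := Set.exists_max_image (supp C) ω (Set.toFinite _) hne
  exact ⟨e, initSet_ne_zero.2 ⟨he, hmax⟩⟩

/-- The members of `init_ω(𝒞)` of a given weight are the circuits of an oriented matroid. -/
theorem exists_level {α : Type*} [Finite α] (M : OrientedMatroid α) (ω : α → ℝ) (w : ℝ) :
    ∃ N : OrientedMatroid α,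
      ∀ X, X ∈ N.circuits ↔ X ∈ initCircuits M ω ∧ ∃ e, X e ≠ 0 ∧ ω e = w := by
  obtain ⟨N, h1, h2⟩ := exists_contract (M.restrict {e | ω e ≤ w}) {e | ω e < w}
  -- a circuit of maximal weight `w`
  have hdel : ∀ C : α → SignType, (∀ e, C e ≠ 0 → ω e ≤ w) → (∃ e, C e ≠ 0 ∧ ω e = w) →
      del {e | ω e < w} C = initSet ω C := by
    rintro C hle ⟨e, he, hew⟩
    ext g
    by_cases hg : C g = 0
    · have : initSet ω C g = 0 := by_contra fun h => (initSet_ne_zero.1 h).1 hg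
      rw [this]
      unfold del
      split_ifs <;> simp [hg]
    · by_cases hgw : ω g < w
      · rw [del_apply_of_mem (show g ∈ {e | ω e < w} from hgw)]
        refine (by_contra fun h => ?_ : initSet ω C g = 0).symm
        have := (initSet_ne_zero.1 h).2 e he
        linarith
      · rw [del_apply_of_notMem (show g ∉ {e | ω e < w} from hgw), initSet_apply]
        exact initSet_ne_zero.2 ⟨hg, fun f hf => (hle f hf).trans (not_lt.1 hgw)⟩
  have hinit : ∀ C : α → SignType, (∃ e, initSet ω C e ≠ 0 ∧ ω e = w) →
      (∀ e, C e ≠ 0 → ω e ≤ w) ∧ (∃ e, C e ≠ 0 ∧ ω e = w) := by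
    rintro C ⟨e, he, hew⟩
    obtain ⟨h3, h4⟩ := initSet_ne_zero.1 he
    exact ⟨fun f hf => hew ▸ h4 f hf, e, h3, hew⟩
  have hcirc : ∀ X ∈ N.circuits, ∃ C ∈ M.circuits, X = initSet ω C ∧
      ∃ e, initSet ω C e ≠ 0 ∧ ω e = w := by
    intro X hX
    obtain ⟨C, ⟨hC, hCw⟩, rfl⟩ := h1 X hX
    obtain ⟨e, he⟩ : ∃ e, del {e | ω e < w} C e ≠ 0 := by
      by_contra! h
      exact N.zero_notMem ((funext h : del {e | ω e < w} C = 0) ▸ hX)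
    have hew : ¬ ω e < w := fun h => he (del_apply_of_mem h)
    rw [del_apply_of_notMem (show e ∉ {e | ω e < w} from hew)] at he
    have hew' : ω e = w := le_antisymm (hCw e he) (not_lt.1 hew)
    refine ⟨C, hC, hdel C hCw ⟨e, he, hew'⟩, e, initSet_ne_zero.2 ⟨he, fun f hf => ?_⟩, hew'⟩
    exact (hCw f hf).trans hew'.ge
  have hbelow : ∀ C ∈ M.circuits, (∃ e, initSet ω C e ≠ 0 ∧ ω e = w) →
      ∃ A ∈ N.circuits, SignedSubset A (initSet ω C) := by
    intro C hC hw
    obtain ⟨hle, e, he, hew⟩ := hinit C hw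
    obtain ⟨A, hA, -, hAs⟩ := h2 C ⟨hC, hle⟩ e (fun h => absurd hew (ne_of_lt h)) he
    exact ⟨A, hA, hdel C hle ⟨e, he, hew⟩ ▸ hAs⟩
  refine ⟨N, fun X => ⟨fun hX => ?_, ?_⟩⟩
  · obtain ⟨C, hC, rfl, hw⟩ := hcirc X hX
    refine ⟨⟨⟨C, hC, rfl⟩, fun D hD hs => ?_⟩, hw⟩
    obtain ⟨e, he⟩ := exists_initSet_ne_zero M ω hD
    have heC : initSet ω C e ≠ 0 := hs e he ▸ he
    have hew : ω e = w := by
      obtain ⟨g, hg, hgw⟩ := hw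
      obtain ⟨h3, h4⟩ := initSet_ne_zero.1 hg
      obtain ⟨h5, h6⟩ := initSet_ne_zero.1 heC
      exact (le_antisymm (h4 e h5) (h6 g h3)).trans hgw
    obtain ⟨A, hA, hAs⟩ := hbelow D hD ⟨e, he, hew⟩
    have hAC : SignedSubset A (initSet ω C) := fun g hg =>
      (hAs g hg).trans (hs g (hAs g hg ▸ hg))
    have hAeq : A = initSet ω C := by
      rcases N.eq_or_eq_neg A hA _ hX (fun g hg => hAC g hg ▸ hg) with h | h
      · exact h
      · exfalso
        have h3 := hAC e (by rw [h]; exact sign_neg_ne.2 heC)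
        rw [h] at h3
        exact sign_ne_neg heC h3.symm
    ext g
    by_cases hg : initSet ω D g = 0
    · have : initSet ω C g = 0 := by
        by_contra hne
        rw [← hAeq] at hne
        exact hne ((hAs g hne).trans hg)
      rw [hg, this]
    · exact hs g hg
  · rintro ⟨⟨⟨C, hC, rfl⟩, hmin⟩, hw⟩
    obtain ⟨A, hA, hAs⟩ := hbelow C hC hw
    obtain ⟨D, hD, rfl, -⟩ := hcirc A hA
    rw [← hmin D hD hAs]
    exact hA

/-- The oriented matroid `M_ω`, which is `M_𝓕` for the flag `𝓕` of `ω`: its signed circuits are the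
inclusion-minimal signed sets among the `init_ω(C)`. -/
def initialMatroid {α : Type*} [Finite α] (M : OrientedMatroid α) (ω : α → ℝ) :
    OrientedMatroid α where
  circuits := initCircuits M ω
  zero_notMem := by
    rintro ⟨⟨C, hC, h⟩, -⟩
    obtain ⟨e, he⟩ := exists_initSet_ne_zero M ω hC
    exact he (congrFun h e).symm
  neg_mem := by
    rintro _ ⟨⟨C, hC, rfl⟩, hmin⟩
    refine ⟨⟨-C, M.neg_mem C hC, (initSet_neg ω C).symm⟩, fun D hD hs => ?_⟩
    have h1 := hmin (-D) (M.neg_mem D hD)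
      (by rw [initSet_neg]; simpa using signedSubset_neg hs)
    rw [← h1, initSet_neg, neg_neg]
  eq_or_eq_neg := by
    rintro _ ⟨⟨C, hC, rfl⟩, hminC⟩ _ ⟨⟨D, hD, rfl⟩, hminD⟩ hs
    obtain ⟨e, he⟩ := exists_initSet_ne_zero M ω hC
    obtain ⟨N, hN⟩ := exists_level M ω (ω e)
    exact N.eq_or_eq_neg _ ((hN _).2 ⟨⟨⟨C, hC, rfl⟩, hminC⟩, e, he, rfl⟩) _
      ((hN _).2 ⟨⟨⟨D, hD, rfl⟩, hminD⟩, e, hs e he, rfl⟩) hs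
  elim := by
    intro X hX Y hY hne e hXe hYe
    obtain ⟨N, hN⟩ := exists_level M ω (ω e)
    obtain ⟨Z, hZ, h⟩ := N.elim X ((hN X).2 ⟨hX, e, by rw [hXe]; decide, rfl⟩)
      Y ((hN Y).2 ⟨hY, e, by rw [hYe]; decide, rfl⟩) hne e hXe hYe
    exact ⟨Z, ((hN Z).1 hZ).1, h⟩

end initial

end OrientedMatroid

/-! Conditions 1 and 2 are equivalent because every `init_ω(C)` contains a minimal one, and a signed
subset of a nonnegative signed set is nonnegative. So acyclicity forces a negative element into each
`init_ω(C)`, and applying this to `-C` gives a positive one.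

Conditions 2 and 3 are linked by a circuit criterion: `F` is a positive flat exactly when every
signed circuit not contained in `F` takes both signs outside `F`. The members of the flag are lower
sets for `ω`, so such a circuit has all of `init_ω(C)` outside `F`. Conversely, if `F` consists of
the elements lighter than the top of `C`, then the part of `C` outside `F` is exactly `init_ω(C)`.

One half of the criterion is orthogonality of circuits and covectors (`IsCovector.orthogonal`). The
other half is a Farkas lemma, `exists_nonneg_cocircuit_delete`, which yields for each `e ∉ F` a
nonnegative signed cocircuit through `e` vanishing on `F`; composing these gives the covector. Its
proof inducts on the elements not yet deleted, forced to zero, or equal to `e`. It needs every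
cocircuit `D` to carry a signature orthogonal to all circuits: contracting the complement of `D`
leaves circuits with two elements, and these dictate the relative signs on `D`. -/

/-- Any two elements of a cocircuit are its intersection with a circuit. -/
theorem Matroid.IsCocircuit.exists_isCircuit_inter_eq_pair {α : Type*} {N : Matroid α} {K : Set α}
    (hK : N.IsCocircuit K) {e g : α} (he : e ∈ K) (hg : g ∈ K) (hne : e ≠ g) :
    ∃ C, N.IsCircuit C ∧ C ∩ K = {e, g} := by
  -- `K \ {e}` is independent in the dual, so some base avoids it. The fundamental circuit of `g`
  -- for that base can meet `K` only in `e` and `g`, and it must contain `e` since a circuit and a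
  -- cocircuit never meet in one element.
  obtain ⟨B', hB', hKB⟩ := (hK.isCircuit.sdiff_singleton_indep he).exists_isBase_superset
  have hB : N.IsBase (N.E \ B') := hB'.compl_isBase_of_dual
  have hgB : g ∈ B' := hKB ⟨hg, hne.symm⟩
  have hC := hB.fundCircuit_isCircuit (hK.subset_ground hg) (fun h => h.2 hgB)
  have hgC := N.mem_fundCircuit g (N.E \ B')
  have hsub : N.fundCircuit g (N.E \ B') ∩ K ⊆ {e, g} := by
    rintro f ⟨hf, hfK⟩
    rcases N.fundCircuit_subset_insert g _ hf with rfl | h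
    · exact Or.inr rfl
    · by_contra hfe
      exact h.2 (hKB ⟨hfK, fun h' => hfe (Or.inl h')⟩)
  refine ⟨_, hC, hsub.antisymm ?_⟩
  have heC : e ∈ N.fundCircuit g (N.E \ B') := by
    by_contra he'
    refine hC.inter_isCocircuit_ne_singleton hK (e := g) (subset_antisymm ?_ ?_)
    · intro f hf
      rcases hsub hf with rfl | h
      · exact absurd hf.1 he'
      · exact h
    · rintro f rfl
      exact ⟨hgC, hg⟩
  rintro f (rfl | rfl)
  · exact ⟨heC, he⟩
  · exact ⟨hgC, hg⟩

namespace OrientedMatroid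

variable {α : Type*}

/-- A form that treats both signs alike: any nonzero product calls for an opposite one, which avoids
separate arguments for `1` and `-1`. -/
theorem orthogonal_iff {X Y : α → SignType} :
    Orthogonal X Y ↔ ∀ e, X e * Y e ≠ 0 → ∃ g, X g * Y g = -(X e * Y e) := by
  constructor
  · intro h e he
    rcases SignType.trichotomy (X e * Y e) with h1 | h1 | h1
    · rw [h1]
      exact h.2 ⟨e, h1⟩
    · exact absurd h1 he
    · rw [h1]
      exact h.1 ⟨e, h1⟩
  · intro h
    refine ⟨fun ⟨e, he⟩ => ?_, fun ⟨e, he⟩ => ?_⟩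
    · have := h e (by rw [he]; decide)
      rwa [he] at this
    · have := h e (by rw [he]; decide)
      rwa [he] at this

theorem exists_ne_zero (M : OrientedMatroid α) {C : α → SignType} (hC : C ∈ M.circuits) :
    ∃ e, C e ≠ 0 := by
  by_contra! h
  exact M.zero_notMem ((funext h : C = 0) ▸ hC)

/-! ### Signatures of cocircuits, by contraction to rank one -/

section rankOne

/-- If no signed circuit has a singleton support and any two elements of `D` are the support of a
signed circuit, then there is a signature of `D` orthogonal to all signed circuits. -/
theorem exists_orthogonal_of_pairs (N : OrientedMatroid α) {D : Set α} {e₀ : α} (he₀ : e₀ ∈ D)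
    (hsub : ∀ A ∈ N.circuits, ∀ e, A e ≠ 0 → e ∈ D ∧ ∃ g, g ≠ e ∧ A g ≠ 0)
    (hpair : ∀ e ∈ D, ∀ g ∈ D, e ≠ g → ∃ A ∈ N.circuits, A e ≠ 0 ∧ A g ≠ 0 ∧
      ∀ h, A h ≠ 0 → h = e ∨ h = g) :
    ∃ Y : α → SignType, supp Y = D ∧ Y e₀ = 1 ∧ ∀ C ∈ N.circuits, Orthogonal C Y := by
  classical
  have hpair₀ : ∀ g, ∃ A : α → SignType, g ∈ D → g ≠ e₀ →
      A ∈ N.circuits ∧ A e₀ = 1 ∧ A g ≠ 0 ∧ ∀ h, A h ≠ 0 → h = e₀ ∨ h = g := by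
    intro g
    by_cases hg : g ∈ D ∧ g ≠ e₀
    · obtain ⟨A, hA, h0, hAg, hs⟩ := hpair e₀ he₀ g hg.1 hg.2.symm
      rcases SignType.trichotomy (A e₀) with h | h | h
      · refine ⟨-A, fun _ _ => ⟨N.neg_mem A hA, by rw [Pi.neg_apply, h]; rfl,
          sign_neg_ne.2 hAg, fun h hh => hs h (sign_neg_ne.1 hh)⟩⟩
      · exact absurd h h0
      · exact ⟨A, fun _ _ => ⟨hA, h, hAg, hs⟩⟩
    · exact ⟨0, fun h1 h2 => absurd ⟨h1, h2⟩ hg⟩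
  choose A hA using hpair₀
  -- Once `Y e₀ = 1`, orthogonality to the circuit `A g` on `{e₀, g}`, normalized by `A g e₀ = 1`,
  -- forces this value at `g`.
  let Y : α → SignType := fun g => if g ∈ D then (if g = e₀ then 1 else -A g g) else 0
  have hY₀ : Y e₀ = 1 := by simp [Y, he₀]
  have hY : ∀ g ∈ D, g ≠ e₀ → Y g = -A g g := fun g hg hne => by simp [Y, hg, hne]
  have hYD : ∀ g ∉ D, Y g = 0 := fun g hg => by simp [Y, hg]
  have hYne : ∀ g ∈ D, Y g ≠ 0 := by
    intro g hg
    by_cases hne : g = e₀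
    · rw [hne, hY₀]; decide
    · rw [hY g hg hne]
      exact sign_neg_ne.2 (hA g hg hne).2.2.1
  have hsq : ∀ a : SignType, a ≠ 0 → a * a = 1 := by decide
  have key : ∀ e ∈ D, ∀ g ∈ D, e ≠ g → ∃ Z ∈ N.circuits, (∀ h, Z h ≠ 0 → h = e ∨ h = g) ∧
      Z e * Y e = 1 ∧ Z g * Y g = -1 := by
    intro e he g hg hne
    by_cases he0 : e = e₀
    · subst he0
      obtain ⟨h1, h2, h3, h4⟩ := hA g hg hne.symm
      refine ⟨A g, h1, h4, by rw [h2, hY₀]; rfl, ?_⟩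
      rw [hY g hg hne.symm, mul_neg, hsq _ h3]
    obtain ⟨h1, h2, h3, h4⟩ := hA e he he0
    by_cases hg0 : g = e₀
    · subst hg0
      refine ⟨-A e, N.neg_mem _ h1, fun h hh => (h4 h (sign_neg_ne.1 hh)).symm, ?_, ?_⟩
      · rw [hY e he he0, Pi.neg_apply, neg_mul_neg, hsq _ h3]
      · rw [hY₀, Pi.neg_apply, h2]; rfl
    obtain ⟨k1, k2, k3, k4⟩ := hA g hg hg0
    have hAeg : A e g = 0 := by
      by_contra h
      exact (h4 g h).elim hg0 hne.symm
    have hAge : A g e = 0 := by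
      by_contra h
      exact (k4 e h).elim he0 hne
    -- Eliminating `e₀` between `A g` and `-A e` leaves a circuit on `{e, g}`, with the signs of `-A
    -- e` at `e` and of `A g` at `g`. Neither element can drop out, as no circuit is a singleton.
    obtain ⟨Z, hZ, hZ0, hZs⟩ := elim_any N.elim k1 (N.neg_mem _ h1)
      (fun h => k3 (by rw [h, neg_neg, hAeg])) (e := e₀) (by rw [k2]; decide)
      (by rw [Pi.neg_apply, h2, k2])
    have hZsupp : ∀ h, Z h ≠ 0 → h = e ∨ h = g := by
      intro h hh
      have hh0 : h ≠ e₀ := by rintro rfl; exact hh hZ0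
      rcases hZs h with hz | hz | hz
      · exact absurd hz hh
      · exact Or.inr ((k4 h (hz ▸ hh)).resolve_left hh0)
      · exact Or.inl ((h4 h (sign_neg_ne.1 (show (-A e) h ≠ 0 from hz ▸ hh))).resolve_left hh0)
    obtain ⟨f, hf⟩ := N.exists_ne_zero hZ
    obtain ⟨-, f', hff', hf'⟩ := hsub Z hZ f hf
    have hZe : Z e ≠ 0 := by
      rcases hZsupp f hf with rfl | rfl
      · exact hf
      · rcases hZsupp f' hf' with rfl | rfl
        · exact hf'
        · exact absurd rfl hff'
    have hZg : Z g ≠ 0 := by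
      rcases hZsupp f hf with rfl | rfl
      · rcases hZsupp f' hf' with rfl | rfl
        · exact absurd rfl hff'
        · exact hf'
      · exact hf
    refine ⟨Z, hZ, hZsupp, ?_, ?_⟩
    · rcases hZs e with hz | hz | hz
      · exact absurd hz hZe
      · exact absurd (hz.trans hAge) hZe
      · rw [hz, hY e he he0, Pi.neg_apply, neg_mul_neg, hsq _ h3]
    · rcases hZs g with hz | hz | hz
      · exact absurd hz hZg
      · rw [hz, hY g hg hg0, mul_neg, hsq _ k3]
      · exact absurd (hz.trans (by rw [Pi.neg_apply, hAeg, neg_zero])) hZg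
  refine ⟨Y, Set.ext fun g => ⟨fun hg => by_contra fun h => hg (hYD g h), hYne g⟩, hY₀,
    fun C hC => orthogonal_iff.2 fun e he => ?_⟩
  have hCe : C e ≠ 0 := fun h => he (by rw [h, zero_mul])
  obtain ⟨heD, g, hge, hCg⟩ := hsub C hC e hCe
  obtain ⟨Z, hZ, hZs, hZe, hZg⟩ := key e heD g (hsub C hC g hCg).1 hge.symm
  refine ⟨g, ?_⟩
  -- The support of `Z` lies in that of `C`, so `C` is `Z` up to sign and its products at `e` and
  -- `g` are opposite too.
  rcases N.eq_or_eq_neg Z hZ C hC (fun h hh => by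
    rcases hZs h hh with rfl | rfl
    · exact hCe
    · exact hCg) with rfl | rfl
  · rw [hZe, hZg]
  · rw [Pi.neg_apply, neg_mul] at hZe hZg
    rw [neg_inj.1 hZg, hZe]

/-- A set that meets no signed circuit in a single element, any two elements of which are the
intersection with a signed circuit, has a signature orthogonal to all signed circuits. -/
theorem exists_orthogonal [Finite α] (K : OrientedMatroid α) {D : Set α} {e₀ : α} (he₀ : e₀ ∈ D)
    (hone : ∀ C ∈ K.circuits, ∀ e ∈ D, C e ≠ 0 → ∃ g ∈ D, g ≠ e ∧ C g ≠ 0)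
    (hpair : ∀ e ∈ D, ∀ g ∈ D, e ≠ g → ∃ C ∈ K.circuits, C e ≠ 0 ∧ C g ≠ 0 ∧
      ∀ h ∈ D, C h ≠ 0 → h = e ∨ h = g) :
    ∃ Y : α → SignType, supp Y = D ∧ Y e₀ = 1 ∧ ∀ C ∈ K.circuits, Orthogonal C Y := by
  -- Orthogonality lifts from the contraction: every element of `C` in `D` lies in a circuit of `N`
  -- that agrees with `C` on its support, so an opposite product found there is also one for `C`.
  obtain ⟨N, h1, h2⟩ := exists_contract K Dᶜ
  have hdel : ∀ {C : α → SignType} {e : α}, del Dᶜ C e ≠ 0 ↔ e ∈ D ∧ C e ≠ 0 := by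
    intro C e
    by_cases he : e ∈ D
    · rw [del_apply_of_notMem (not_not.2 he)]
      exact ⟨fun h => ⟨he, h⟩, fun h => h.2⟩
    · rw [del_apply_of_mem (Set.mem_compl he)]
      exact ⟨fun h => absurd rfl h, fun h => absurd h.1 he⟩
  have hdel' : ∀ {C : α → SignType} {e : α}, del Dᶜ C e ≠ 0 → del Dᶜ C e = C e := fun h =>
    del_apply_of_notMem (not_not.2 (hdel.1 h).1)
  have hsub : ∀ A ∈ N.circuits, ∀ e, A e ≠ 0 → e ∈ D ∧ ∃ g, g ≠ e ∧ A g ≠ 0 := by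
    intro A hA e he
    obtain ⟨C, hC, rfl⟩ := h1 A hA
    obtain ⟨heD, hCe⟩ := hdel.1 he
    obtain ⟨g, hgD, hge, hCg⟩ := hone C hC e heD hCe
    exact ⟨heD, g, hge, hdel.2 ⟨hgD, hCg⟩⟩
  obtain ⟨Y, hYD, hY₀, hY⟩ := N.exists_orthogonal_of_pairs he₀ hsub (by
    intro e he g hg hne
    obtain ⟨C, hC, hCe, hCg, hCs⟩ := hpair e he g hg hne
    obtain ⟨A, hA, hAe, hAs⟩ := h2 C hC e (not_not.2 he) hCe
    have hAsupp : ∀ h, A h ≠ 0 → h = e ∨ h = g := by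
      intro h hh
      obtain ⟨hhD, hCh⟩ := hdel.1 (hAs h hh ▸ hh)
      exact hCs h hhD hCh
    obtain ⟨-, f, hfe, hAf⟩ := hsub A hA e hAe
    exact ⟨A, hA, hAe, (hAsupp f hAf).resolve_left hfe ▸ hAf, hAsupp⟩)
  refine ⟨Y, hYD, hY₀, fun C hC => orthogonal_iff.2 fun e he => ?_⟩
  have hCe : C e ≠ 0 := fun h => he (by rw [h, zero_mul])
  have hYe : e ∈ D := hYD ▸ (fun h => he (by rw [h, mul_zero]) : Y e ≠ 0)
  obtain ⟨A, hA, hAe, hAs⟩ := h2 C hC e (not_not.2 hYe) hCe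
  have hAC : ∀ h, A h ≠ 0 → A h = C h := fun h hh => (hAs h hh).trans (hdel' (hAs h hh ▸ hh))
  obtain ⟨g, hg⟩ := orthogonal_iff.1 (hY A hA) e (by rwa [hAC e hAe])
  rw [hAC e hAe] at hg
  have hAg : A g ≠ 0 := by
    intro h
    rw [h, zero_mul] at hg
    exact sign_neg_ne.2 he hg.symm
  exact ⟨g, by rw [← hAC g hAg, hg]⟩

end rankOne

/-! ### Circuits of the underlying matroid and of its deletions -/

section underlying

theorem underlying_indep_iff [Finite α] (M : OrientedMatroid α) {I : Set α} :
    M.underlying.Indep I ↔ ∀ C ∈ M.circuits, ¬ supp C ⊆ I := Iff.rfl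

theorem isCircuit_underlying_iff [Finite α] (M : OrientedMatroid α) {S : Set α} :
    M.underlying.IsCircuit S ↔ ∃ C ∈ M.circuits, supp C = S := by
  rw [Matroid.isCircuit_iff_minimal_not_indep (Set.subset_univ _), minimal_iff_forall_lt]
  constructor
  · rintro ⟨h1, h2⟩
    rw [underlying_indep_iff] at h1
    push Not at h1
    obtain ⟨C, hC, hCS⟩ := h1
    refine ⟨C, hC, hCS.eq_of_not_ssubset fun hss => h2 hss fun hi => ?_⟩
    exact M.underlying_indep_iff.1 hi C hC subset_rfl
  · rintro ⟨C, hC, rfl⟩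
    refine ⟨fun hi => M.underlying_indep_iff.1 hi C hC subset_rfl, fun S hS hi => hi ?_⟩
    refine M.underlying_indep_iff.2 fun D hD hDS => hS.not_subset ?_
    rcases M.eq_or_eq_neg D hD C hC (fun e he => hS.subset (hDS he)) with rfl | rfl
    · exact hDS
    · exact fun e he => hDS (sign_neg_ne.2 he)

theorem isCircuit_delete_iff [Finite α] (M : OrientedMatroid α) {T S : Set α} :
    (M.underlying.delete T).IsCircuit S ↔ ∃ C ∈ (M.restrict Tᶜ).circuits, supp C = S := by
  rw [Matroid.delete_isCircuit_iff, isCircuit_underlying_iff]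
  constructor
  · rintro ⟨⟨C, hC, rfl⟩, hd⟩
    exact ⟨C, ⟨hC, fun e he => Set.disjoint_left.1 hd he⟩, rfl⟩
  · rintro ⟨C, ⟨hC, hs⟩, rfl⟩
    exact ⟨⟨C, hC, rfl⟩, Set.disjoint_left.2 hs⟩

end underlying

/-! ### Farkas' lemma for oriented matroids -/

section farkas

/-- Every cocircuit of a deletion of the underlying matroid has a signature orthogonal to all signed
circuits of the deletion. -/
theorem exists_orthogonal_of_isCocircuit [Finite α] (M : OrientedMatroid α) {T D : Set α}
    (hD : (M.underlying.delete T).IsCocircuit D) {e : α} (he : e ∈ D) :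
    ∃ Y : α → SignType, supp Y = D ∧ Y e = 1 ∧ ∀ C ∈ (M.restrict Tᶜ).circuits, Orthogonal C Y := by
  refine exists_orthogonal _ he (fun C hC f hf hCf => ?_) (fun f hf g hg hne => ?_)
  · by_contra! h
    refine (M.isCircuit_delete_iff.2 ⟨C, hC, rfl⟩).inter_isCocircuit_ne_singleton hD (e := f) ?_
    ext g
    refine ⟨fun hg => by_contra fun hgf => hg.1 (h g hg.2 hgf), ?_⟩
    rintro rfl
    exact ⟨hCf, hf⟩
  · obtain ⟨S, hS, hSD⟩ := hD.exists_isCircuit_inter_eq_pair hf hg hne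
    obtain ⟨C, hC, rfl⟩ := M.isCircuit_delete_iff.1 hS
    have h1 : f ∈ supp C ∩ D := hSD ▸ Or.inl rfl
    have h2 : g ∈ supp C ∩ D := hSD ▸ Or.inr rfl
    refine ⟨C, hC, h1.1, h2.1, fun h hh hCh => ?_⟩
    have h3 : h ∈ supp C ∩ D := ⟨hCh, hh⟩
    rwa [hSD] at h3

/-- Orthogonality along a circuit that meets the support of `Y` in two elements. -/
theorem Orthogonal.mul_eq_neg {C Y : α → SignType} (h : Orthogonal C Y) {e g : α}
    (he : C e * Y e ≠ 0) (hs : ∀ f, C f * Y f ≠ 0 → f = e ∨ f = g) : C g * Y g = -(C e * Y e) := by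
  obtain ⟨f, hf⟩ := orthogonal_iff.1 h e he
  rcases hs f (by rw [hf]; exact sign_neg_ne.2 he) with rfl | rfl
  · exact absurd hf (sign_ne_neg he)
  · exact hf

/-- A signed cocircuit of the deletion of `insert f T` extends to one of the deletion of `T`. -/
theorem exists_extend_cocircuit [Finite α] (M : OrientedMatroid α) {T : Set α} {f : α}
    {Y' : α → SignType} (hco : (M.underlying.delete (insert f T)).IsCocircuit (supp Y'))
    (hY' : ∀ C ∈ (M.restrict (insert f T)ᶜ).circuits, Orthogonal C Y') {e : α} (he : Y' e = 1) :
    ∃ Y : α → SignType, (M.underlying.delete T).IsCocircuit (supp Y) ∧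
      (∀ C ∈ (M.restrict Tᶜ).circuits, Orthogonal C Y) ∧ ∀ g, g ≠ f → Y g = Y' g := by
  have heD' : e ∈ supp Y' := by
    show Y' e ≠ 0
    rw [he]; decide
  have hdel : M.underlying.delete (insert f T) = (M.underlying.delete T).delete {f} := by
    rw [Matroid.delete_delete, Set.union_singleton]
  have hco' := hco
  -- Deletion is dual to contraction: a circuit of the dual contracted by `f` becomes a circuit of
  -- the dual after adding at most `f`.
  rw [hdel, Matroid.isCocircuit_def, Matroid.dual_delete] at hco'
  obtain ⟨D, hD, hD'D, hDD'⟩ := hco'.exists_subset_isCircuit_of_contract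
  obtain ⟨Y, hYD, hYe, hY⟩ := M.exists_orthogonal_of_isCocircuit hD (hD'D heD')
  subst hYD
  refine ⟨Y, hD, hY, fun g hgf => ?_⟩
  by_cases hge : g = e
  · rw [hge, hYe, he]
  by_cases hg : Y' g = 0
  · rw [hg]
    by_contra h
    exact (hDD' h).elim (fun h' => h' hg) hgf
  -- A circuit of the smaller deletion meeting `supp Y'` in `{e, g}` misses `f`, so orthogonality to
  -- it determines both `Y g` and `Y' g` from the common value at `e`.
  obtain ⟨S, hS, hSD⟩ := hco.exists_isCircuit_inter_eq_pair heD' (show g ∈ supp Y' from hg)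
    (Ne.symm hge)
  obtain ⟨C, hC, rfl⟩ := M.isCircuit_delete_iff.1 hS
  have hCe : C e ≠ 0 := (hSD ▸ Or.inl rfl : e ∈ supp C ∩ supp Y').1
  have hCg : C g ≠ 0 := (hSD ▸ Or.inr rfl : g ∈ supp C ∩ supp Y').1
  have hCf : C f = 0 := by
    by_contra h
    exact hC.2 f h (Or.inl rfl)
  have hs' : ∀ h, C h * Y' h ≠ 0 → h = e ∨ h = g := by
    intro h hh
    have h3 : h ∈ supp C ∩ supp Y' := ⟨left_ne_zero_of_mul hh, right_ne_zero_of_mul hh⟩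
    rwa [hSD] at h3
  have h1 := (hY' C hC).mul_eq_neg (e := e) (g := g)
    (mul_ne_zero hCe (by rw [he]; decide)) hs'
  have h2 := (hY C ⟨hC.1, fun h hh hT => hC.2 h hh (Or.inr hT)⟩).mul_eq_neg (e := e) (g := g)
    (mul_ne_zero hCe (by rw [hYe]; decide)) (fun h hh => by
      have hCh := left_ne_zero_of_mul hh
      refine hs' h (mul_ne_zero hCh ?_)
      refine (hDD' (right_ne_zero_of_mul hh)).resolve_right ?_
      rintro rfl
      exact hCh hCf)
  rw [he, ← hYe, ← h2] at h1
  exact (mul_left_cancel₀ hCg h1).symm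

/-- Farkas' lemma: if no signed circuit that avoids `T` and contains `e` positively is nonnegative
off `F`, then there is a nonnegative signed cocircuit through `e` in the deletion of `T` that
vanishes on `F`. -/
theorem exists_nonneg_cocircuit_delete [Finite α] (M : OrientedMatroid α) (T F : Set α) {e : α}
    (heT : e ∉ T) (heF : e ∉ F)
    (h : ∀ C ∈ (M.restrict Tᶜ).circuits, C e = 1 → ∃ f ∉ F, C f = -1) :
    ∃ Y : α → SignType, (M.underlying.delete T).IsCocircuit (supp Y) ∧
      (∀ C ∈ (M.restrict Tᶜ).circuits, Orthogonal C Y) ∧ Y e = 1 ∧ (∀ g, Y g = 0 ∨ Y g = 1) ∧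
      ∀ g ∈ F, Y g = 0 := by
  -- `T` collects the deleted elements and `F` those where `Y` must vanish; each step moves one free
  -- element `f` into one of them.
  induction hk : (insert e (T ∪ F))ᶜ.ncard using Nat.strong_induction_on generalizing T F with
  | _ k ih =>
  by_cases hf : ∃ f, f ∉ T ∧ f ∉ F ∧ f ≠ e
  · obtain ⟨f, hfT, hfF, hfe⟩ := hf
    have hlt : ∀ T' F' : Set α, T' ∪ F' = insert f (T ∪ F) →
        (insert e (T' ∪ F'))ᶜ.ncard < k := by
      intro T' F' hTF
      rw [← hk, hTF]
      refine Set.ncard_lt_ncard ⟨Set.compl_subset_compl.2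
        (Set.insert_subset_insert (Set.subset_insert _ _)), fun hsub => ?_⟩ (Set.toFinite _)
      rcases Set.compl_subset_compl.1 hsub (Or.inr (Or.inl rfl)) with h1 | h1 | h1
      · exact hfe h1
      · exact hfT h1
      · exact hfF h1
    by_cases hc : ∀ C ∈ (M.restrict Tᶜ).circuits, C e = 1 → ∃ g ∉ insert f F, C g = -1
    · obtain ⟨Y, h1, h2, h3, h4, h5⟩ := ih _ (hlt T (insert f F) Set.union_insert) T (insert f F)
        heT (fun h => h.elim (Ne.symm hfe) heF) hc rfl
      exact ⟨Y, h1, h2, h3, h4, fun g hg => h5 g (Or.inr hg)⟩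
    · push Not at hc
      obtain ⟨C, hC, hCe, hCn⟩ := hc
      -- If `f` cannot be added to `F`, it can be deleted, because the hypothesis passes to the
      -- fewer circuits avoiding `f`. The obstructing circuit `C` will then control the sign of the
      -- extension at `f`.
      obtain ⟨Y', h1, h2, h3, h4, h5⟩ := ih _ (hlt (insert f T) F Set.insert_union) (insert f T) F
        (fun h => h.elim (Ne.symm hfe) heT) heF
        (fun D hD => h D ⟨hD.1, fun g hg hT => hD.2 g hg (Or.inr hT)⟩) rfl
      obtain ⟨Y, hco, hY, hYY'⟩ := M.exists_extend_cocircuit h1 h2 h3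
      have hYe : Y e = 1 := (hYY' e (Ne.symm hfe)).trans h3
      refine ⟨Y, hco, hY, hYe, fun g => ?_, fun g hg => ?_⟩
      · by_cases hgf : g = f
        · subst hgf
          by_contra! hY1
          have hYg : Y g = -1 := by
            rcases SignType.trichotomy (Y g) with h | h | h
            · exact h
            · exact absurd h hY1.1
            · exact absurd h hY1.2
          have hCg : C g = -1 := by
            obtain ⟨g', hg', hCg'⟩ := h C hC hCe
            by_cases hgg : g' = g
            · exact hgg ▸ hCg'
            · exact absurd hCg' (hCn g' (fun h => h.elim hgg hg'))
          -- Now `C` and `Y` are both `-1` at `f`, `Y` vanishes on `F`, and elsewhere neither is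
          -- negative. All products are thus nonnegative, while the one at `e` is `1`, contradicting
          -- orthogonality.
          obtain ⟨g', hg'⟩ := (hY C hC).1 ⟨e, by rw [hCe, hYe]; rfl⟩
          by_cases hgg : g' = g
          · rw [hgg, hCg, hYg] at hg'
            exact absurd hg' (by decide)
          · rcases h4 g' with h0 | h0
            · rw [hYY' g' hgg, h0, mul_zero] at hg'
              exact absurd hg' (by decide)
            · rw [hYY' g' hgg, h0, mul_one] at hg'
              refine hCn g' (fun h => h.elim hgg fun hF => ?_) hg'
              rw [h5 g' hF] at h0
              exact absurd h0 (by decide)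
        · rw [hYY' g hgf]
          exact h4 g
      · rw [hYY' g (by rintro rfl; exact hfF hg)]
        exact h5 g hg
  · push Not at hf
    -- With no free element left, a circuit positive at `e` would have to be negative at `e` as
    -- well. Hence `e` lies in no circuit avoiding `T`: it is a coloop of the deletion, and the
    -- indicator of `e` serves as `Y`.
    have hno : ∀ C ∈ (M.restrict Tᶜ).circuits, C e = 0 := by
      have hpos : ∀ C ∈ (M.restrict Tᶜ).circuits, C e ≠ 1 := by
        intro C hC hCe
        obtain ⟨f, hfF, hCf⟩ := h C hC hCe
        have hfT : f ∉ T := hC.2 f (by rw [hCf]; decide)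
        rw [hf f hfT hfF, hCe] at hCf
        exact absurd hCf (by decide)
      intro C hC
      rcases SignType.trichotomy (C e) with h | h | h
      · exact absurd (by rw [Pi.neg_apply, h]; rfl) (hpos (-C) ((M.restrict Tᶜ).neg_mem C hC))
      · exact h
      · exact absurd h (hpos C hC)
    classical
    let Y : α → SignType := fun g => if g = e then 1 else 0
    have hYe : Y e = 1 := if_pos rfl
    have hYne : ∀ g, g ≠ e → Y g = 0 := fun g hg => if_neg hg
    have hsupp : supp Y = {e} := by
      ext g
      refine ⟨fun hg => by_contra fun h => hg (hYne g h), ?_⟩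
      rintro rfl
      show Y g ≠ 0
      rw [hYe]; decide
    refine ⟨Y, ?_, fun C hC => orthogonal_iff.2 fun g hg => ?_, hYe, fun g => ?_, fun g hg => ?_⟩
    · rw [hsupp]
      have hiff := (Matroid.isColoop_tfae (M.underlying.delete T) e).out 4 2
      refine hiff.1 ⟨fun S hS heS => ?_, ⟨Set.mem_univ e, heT⟩⟩
      obtain ⟨C, hC, rfl⟩ := M.isCircuit_delete_iff.1 hS
      exact heS (hno C hC)
    · by_cases hge : g = e
      · rw [hge, hno C hC, zero_mul] at hg
        exact absurd rfl hg
      · rw [hYne g hge, mul_zero] at hg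
        exact absurd rfl hg
    · by_cases hge : g = e
      · exact Or.inr (hge ▸ hYe)
      · exact Or.inl (hYne g hge)
    · exact hYne g (by rintro rfl; exact heF hg)

theorem exists_nonneg_signedCocircuit [Finite α] (M : OrientedMatroid α) {F : Set α} {e : α}
    (heF : e ∉ F) (h : ∀ C ∈ M.circuits, C e = 1 → ∃ f ∉ F, C f = -1) :
    ∃ Y : α → SignType, M.IsSignedCocircuit Y ∧ Y e = 1 ∧ (∀ g, Y g = 0 ∨ Y g = 1) ∧
      ∀ g ∈ F, Y g = 0 := by
  obtain ⟨Y, h1, h2, h3⟩ := M.exists_nonneg_cocircuit_delete ∅ F (Set.notMem_empty e) heF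
    (fun C hC => h C hC.1)
  rw [Matroid.delete_empty] at h1
  exact ⟨Y, ⟨h1, fun C hC => h2 C ⟨hC, fun g _ => Set.notMem_empty g⟩⟩, h3⟩

end farkas

/-! ### Positive flats in terms of signed circuits -/

section positiveFlats

/-- If `C` meets the support of `X`, the products there already take both signs and survive in the
composition. Otherwise only the products with `Y` remain. -/
theorem IsCovector.orthogonal [Finite α] {M : OrientedMatroid α} {v : α → SignType}
    (hv : M.IsCovector v) {C : α → SignType} (hC : C ∈ M.circuits) : Orthogonal C v := by
  induction hv with
  | zero => exact orthogonal_iff.2 fun e he => absurd (mul_zero _) he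
  | comp X Y hX _ ih =>
    by_cases hCX : ∃ e, C e * X e ≠ 0
    · have hcomp : ∀ g, C g * X g ≠ 0 → C g * OrientedMatroid.comp X Y g = C g * X g := by
        intro g hg
        rw [OrientedMatroid.comp, if_neg (right_ne_zero_of_mul hg)]
      obtain ⟨e, he⟩ := hCX
      obtain ⟨g, hg⟩ := orthogonal_iff.1 (hX.2 C hC) e he
      have hg0 : C g * X g ≠ 0 := by rw [hg]; exact sign_neg_ne.2 he
      refine orthogonal_iff.2 fun f hf => ?_
      have h1 := sign_eq_or hf he
      rw [← hcomp e he] at h1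
      rcases h1 with h1 | h1
      · exact ⟨g, by rw [h1, hcomp g hg0, hcomp e he, hg]⟩
      · exact ⟨e, by rw [h1, neg_neg]⟩
    · push Not at hCX
      have hcomp : ∀ g, C g * OrientedMatroid.comp X Y g = C g * Y g := by
        intro g
        rw [OrientedMatroid.comp]
        split_ifs with h
        · rfl
        · rcases mul_eq_zero.1 (hCX g) with h' | h'
          · rw [h', zero_mul, zero_mul]
          · exact absurd h' h
      simpa only [Orthogonal, hcomp] using ih

/-- Finitely many nonnegative signed cocircuits that cover the complement of `F` and vanish on `F`
compose to a nonnegative covector with zero set `F`. -/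
theorem exists_nonneg_covector [Finite α] (M : OrientedMatroid α) {F : Set α}
    (h : ∀ e ∉ F, ∃ Y : α → SignType, M.IsSignedCocircuit Y ∧ Y e = 1 ∧
      (∀ g, Y g = 0 ∨ Y g = 1) ∧ ∀ g ∈ F, Y g = 0) :
    ∃ v, M.IsCovector v ∧ (∀ e, v e = 0 ∨ v e = 1) ∧ F = {e | v e = 0} := by
  have key : ∀ S : Set α, S ⊆ Fᶜ → ∃ v, M.IsCovector v ∧ (∀ e, v e = 0 ∨ v e = 1) ∧
      (∀ e ∈ F, v e = 0) ∧ ∀ e ∈ S, v e = 1 := by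
    intro S
    induction S, Set.toFinite S using Set.Finite.induction_on with
    | empty =>
      exact fun _ => ⟨0, .zero, fun _ => Or.inl rfl, fun _ _ => rfl, fun _ h => h.elim⟩
    | @insert e S _ _ ih =>
      intro hS
      obtain ⟨v, hv, h1, h2, h3⟩ := ih ((Set.subset_insert _ _).trans hS)
      obtain ⟨Y, hY, hYe, hY1, hYF⟩ := h e (hS (Set.mem_insert _ _))
      refine ⟨comp Y v, .comp Y v hY hv, fun g => ?_, fun g hg => ?_, fun g hg => ?_⟩
      · unfold comp
        split_ifs
        · exact h1 g
        · exact hY1 g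
      · rw [comp, if_pos (hYF g hg), h2 g hg]
      · unfold comp
        rcases hg with rfl | hg
        · rw [if_neg (by rw [hYe]; decide), hYe]
        · split_ifs with h0
          · exact h3 g hg
          · exact (hY1 g).resolve_left h0
  obtain ⟨v, hv, h1, h2, h3⟩ := key Fᶜ subset_rfl
  refine ⟨v, hv, h1, Set.ext fun e => ⟨h2 e, fun he => by_contra fun h => ?_⟩⟩
  rw [Set.mem_ofPred_eq, h3 e h] at he
  exact absurd he (by decide)

/-- A set is a positive flat if every signed circuit not contained in it has both signs outside. -/
theorem isPositiveFlat_of_circuits [Finite α] (M : OrientedMatroid α) {F : Set α}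
    (h : ∀ C ∈ M.circuits, ∀ e ∉ F, C e ≠ 0 → (∃ f ∉ F, C f = 1) ∧ ∃ f ∉ F, C f = -1) :
    M.IsPositiveFlat F := by
  -- For closedness, an element `e` of the closure outside `F` would give a circuit in `insert e F`,
  -- whose single element outside `F` cannot have both signs. The case `F = univ` needs no separate
  -- treatment: the empty composition has it as zero set.
  refine ⟨Matroid.isFlat_iff_closure_eq.2 (subset_antisymm (fun e he => ?_)
    (Matroid.subset_closure _ _ (Set.subset_univ _))), Or.inr (M.exists_nonneg_covector
    fun e he => M.exists_nonneg_signedCocircuit he fun C hC hCe =>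
      (h C hC e he (by rw [hCe]; decide)).2)⟩
  by_contra heF
  obtain ⟨S, hSF, hS, heS⟩ := Matroid.exists_isCircuit_of_mem_closure he heF
  obtain ⟨C, hC, rfl⟩ := M.isCircuit_underlying_iff.1 hS
  obtain ⟨⟨f, hf, hf1⟩, g, hg, hg1⟩ := h C hC e heF heS
  have hfe : f = e := (hSF (show C f ≠ 0 by rw [hf1]; decide)).resolve_right hf
  have hge : g = e := (hSF (show C g ≠ 0 by rw [hg1]; decide)).resolve_right hg
  rw [hfe] at hf1
  rw [hge, hf1] at hg1
  exact absurd hg1 (by decide)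

/-- A nonnegative covector `v` makes each nonzero product `C f * v f` equal to `C f`, so
orthogonality of `C` and `v` speaks about the signs of `C` off the zero set of `v`. -/
theorem IsPositiveFlat.exists_both_signs [Finite α] {M : OrientedMatroid α} {F : Set α}
    (hF : M.IsPositiveFlat F) {C : α → SignType} (hC : C ∈ M.circuits) {e : α} (he : e ∉ F)
    (hCe : C e ≠ 0) : (∃ f ∉ F, C f = 1) ∧ ∃ f ∉ F, C f = -1 := by
  obtain ⟨-, rfl | ⟨v, hv, hv1, rfl⟩⟩ := hF
  · exact absurd (Set.mem_univ e) he
  have hsign : ∀ s : SignType, s ≠ 0 → (∃ f, C f * v f = s) → ∃ f ∉ {e | v e = 0}, C f = s := by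
    rintro s hs ⟨f, rfl⟩
    have hf : v f ≠ 0 := right_ne_zero_of_mul hs
    exact ⟨f, hf, by rw [(hv1 f).resolve_left hf, mul_one]⟩
  have horth := hv.orthogonal hC
  have hmul : C e * v e ≠ 0 := mul_ne_zero hCe he
  have hboth : (∃ f, C f * v f = 1) ∧ ∃ f, C f * v f = -1 := by
    rcases SignType.trichotomy (C e * v e) with h | h | h
    · exact ⟨horth.2 ⟨e, h⟩, e, h⟩
    · exact absurd h hmul
    · exact ⟨⟨e, h⟩, horth.1 ⟨e, h⟩⟩
  exact ⟨hsign 1 (by decide) hboth.1, hsign (-1) (by decide) hboth.2⟩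

end positiveFlats

/-! ### Initial circuits, acyclicity and the flag of the weight -/

section initial

/-- Every `init_ω(C)` contains a signed circuit of `M_ω`. -/
theorem exists_mem_initCircuits_signedSubset [Finite α] (M : OrientedMatroid α) (ω : α → ℝ)
    {C : α → SignType} (hC : C ∈ M.circuits) :
    ∃ X ∈ M.initCircuits ω, SignedSubset X (initSet ω C) := by
  induction hk : (supp (initSet ω C)).ncard using Nat.strong_induction_on generalizing C with
  | _ k ih =>
  by_cases hmin : ∀ D ∈ M.circuits, SignedSubset (initSet ω D) (initSet ω C) →
      initSet ω D = initSet ω C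
  · exact ⟨_, ⟨⟨C, hC, rfl⟩, hmin⟩, fun _ _ => rfl⟩
  · push Not at hmin
    obtain ⟨D, hD, hs, hne⟩ := hmin
    obtain ⟨X, hX, hXD⟩ := ih _ (by
      rw [← hk]
      refine Set.ncard_lt_ncard ⟨fun e he => show initSet ω C e ≠ 0 from hs e he ▸ he,
        fun hsub => hne ?_⟩ (Set.toFinite _)
      ext e
      by_cases he : initSet ω C e = 0
      · by_contra h
        exact (fun h0 : initSet ω D e ≠ 0 => h0 ((hs e h0).trans he))
          (fun h0 => h (h0.trans he.symm))
      · exact hs e (hsub he)) hD rfl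
    exact ⟨X, hX, fun e he => (hXD e he).trans (hs e (hXD e he ▸ he))⟩

theorem initialMatroid_isAcyclic_iff [Finite α] (M : OrientedMatroid α) (ω : α → ℝ) :
    (M.initialMatroid ω).IsAcyclic ↔
      ∀ C ∈ M.circuits, (∃ e, initSet ω C e = 1) ∧ (∃ e, initSet ω C e = -1) := by
  constructor
  · intro h
    have hneg : ∀ C ∈ M.circuits, ∃ e, initSet ω C e = -1 := by
      intro C hC
      by_contra! hn
      obtain ⟨X, hX, hXC⟩ := M.exists_mem_initCircuits_signedSubset ω hC
      refine h ⟨X, hX, fun e => ?_⟩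
      rcases SignType.trichotomy (X e) with h1 | h1 | h1
      · exact absurd ((hXC e (by rw [h1]; decide)).symm.trans h1) (hn e)
      · exact Or.inl h1
      · exact Or.inr h1
    refine fun C hC => ⟨?_, hneg C hC⟩
    obtain ⟨e, he⟩ := hneg (-C) (M.neg_mem C hC)
    rw [initSet_neg, Pi.neg_apply, neg_inj] at he
    exact ⟨e, he⟩
  · rintro h ⟨X, ⟨⟨C, hC, rfl⟩, -⟩, hpos⟩
    obtain ⟨e, he⟩ := (h C hC).2
    have := hpos e
    rw [he] at this
    exact absurd this (by decide)

/-- By finiteness, a nonempty strict sublevel set is the weak one at the largest value it contains.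
-/
theorem setOf_lt_mem_flag [Finite α] (ω : α → ℝ) (w : ℝ) : {f | ω f < w} ∈ flag ω := by
  by_cases h : {f | ω f < w}.Nonempty
  · obtain ⟨e, he, hmax⟩ := Set.exists_max_image _ ω (Set.toFinite _) h
    exact Or.inr ⟨e, Set.ext fun f => ⟨hmax f, fun hf => lt_of_le_of_lt (b := ω e) hf he⟩⟩
  · exact Or.inl (Set.not_nonempty_iff_eq_empty.1 h)

theorem mem_of_mem_flag {ω : α → ℝ} {F : Set α} (hF : F ∈ flag ω) {f g : α} (hf : f ∈ F)
    (hgf : ω g ≤ ω f) : g ∈ F := by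
  rcases hF with rfl | ⟨e, rfl⟩
  · exact hf.elim
  · exact hgf.trans hf

theorem forall_initSet_iff_forall_isPositiveFlat [Finite α] (M : OrientedMatroid α) (ω : α → ℝ) :
    (∀ C ∈ M.circuits, (∃ e, initSet ω C e = 1) ∧ (∃ e, initSet ω C e = -1)) ↔
      ∀ F ∈ flag ω, M.IsPositiveFlat F := by
  constructor
  · intro h F hF
    refine M.isPositiveFlat_of_circuits fun C hC e he hCe => ?_
    have key : ∀ s : SignType, s ≠ 0 → (∃ f, initSet ω C f = s) → ∃ f ∉ F, C f = s := by
      rintro s hs ⟨f, rfl⟩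
      exact ⟨f, fun hf => he (mem_of_mem_flag hF hf ((initSet_ne_zero.1 hs).2 e hCe)),
        (initSet_apply hs).symm⟩
    exact ⟨key 1 (by decide) (h C hC).1, key (-1) (by decide) (h C hC).2⟩
  · intro h C hC
    obtain ⟨e, he⟩ := exists_initSet_ne_zero M ω hC
    obtain ⟨hCe, hmax⟩ := initSet_ne_zero.1 he
    have key : ∀ s : SignType, s ≠ 0 → (∃ f ∉ {f | ω f < ω e}, C f = s) →
        ∃ f, initSet ω C f = s := by
      rintro s hs ⟨f, hf, rfl⟩
      exact ⟨f, initSet_apply (initSet_ne_zero.2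
        ⟨hs, fun g hg => (hmax g hg).trans (not_lt.1 hf)⟩)⟩
    -- The flag member just below the top weight of `C` is the one to test, since only `init_ω(C)`
    -- remains of `C` outside it.
    have hb := (h _ (setOf_lt_mem_flag ω (ω e))).exists_both_signs hC (lt_irrefl (ω e)) hCe
    exact ⟨key 1 (by decide) hb.1, key (-1) (by decide) hb.2⟩

end initial

end OrientedMatroid

theorem mainTheorem1 (n : ℕ) (M : OrientedMatroid (Fin n)) (ω : Fin n → ℝ) :
    List.TFAE [
      (M.initialMatroid ω).IsAcyclic,
      ∀ C ∈ M.circuits,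
        (∃ e, OrientedMatroid.initSet ω C e = 1) ∧ (∃ e, OrientedMatroid.initSet ω C e = -1),
      ∀ F ∈ OrientedMatroid.flag ω, M.IsPositiveFlat F] := by
  tfae_have 1 ↔ 2 := M.initialMatroid_isAcyclic_iff ω
  tfae_have 2 ↔ 3 := M.forall_initSet_iff_forall_isPositiveFlat ω
  tfae_finish
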